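/- For a field $\mathbb K$ consider the subalgebra $\mathbb K[u,u^3v^4,uv]\subseteq\mathbb K[u,v]$ and, for $n\ge 0$, its ideal $J_n=\langle u-1,\,u^3v^4-1,\,uv-1\rangle^{n+1}$. Order the monomials by $u^av^b\preceq u^cv^d$ if and only if $(2a-b,\,a+b)\le(2c-d,\,c+d)$ lexicographically, that is, use the monomial order defined by the matrix $\begin{pmatrix}2&-1\\1&1\end{pmatrix}$. A reduced marked Gröbner basis of $J_n$ with respect to $\preceq$ is a finite set of pairs $(g,\alpha)$ such that $g\in J_n$ is nonzero with leading coefficient $1$ and leading exponent $\alpha\in\mathbb Z^2$, the leading monomials generate the initial ideal $\langle \operatorname{lm}(f) : 0\ne f\in J_n\rangle$ of $\mathbb K[u,u^3v^4,uv]$, and no monomial of any $g$ is divisible in $\mathbb K[u,u^3v^4,uv]$ by the leading monomial of another element of the set. Let $p$ be a prime and let $\mathbb K$ be a field of characteristic $p$. Then $J_n\subseteq\mathbb C[u,u^3v^4,uv]$ and $J_n\subseteq\mathbb K[u,u^3v^4,uv]$ have unique reduced marked Gröbner bases $\mathbb G_n^{(0)}$ and $\mathbb G_n^{(p)}$, respectively;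 every polynomial $g$ occurring in $\mathbb G_n^{(0)}$ lies in $\mathbb Z[u,u^3v^4,uv]$; and $$\mathbb G_n^{(p)}=\{(g^{(p)},\alpha) : (g,\alpha)\in\mathbb G_n^{(0)}\},$$ where $g^{(p)}\in\mathbb K[u,u^3v^4,uv]$ is obtained from $g$ by reducing its coefficients modulo $p$ and applying the inclusion $\mathbb Z/p\mathbb Z\hookrightarrow\mathbb K$. -/

import Mathlib

open MvPolynomial

namespace A3

noncomputable section

/-- The algebra `R[u, u³v⁴, uv]`, as a subalgebra of the polynomial ring `R[u, v]`
(`u = X 0`, `v = X 1`). -/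
def toricAlg (R : Type*) [CommRing R] : Subalgebra R (MvPolynomial (Fin 2) R) :=
  Algebra.adjoin R {X 0, X 0 ^ 3 * X 1 ^ 4, X 0 * X 1}

section Generators

variable (R : Type*) [CommRing R]

/-- The element `u`. -/
def genU : toricAlg R := ⟨X 0, Algebra.subset_adjoin (by simp)⟩

/-- The element `u³v⁴`. -/
def genW : toricAlg R := ⟨X 0 ^ 3 * X 1 ^ 4, Algebra.subset_adjoin (by simp)⟩

/-- The element `uv`. -/
def genT : toricAlg R := ⟨X 0 * X 1, Algebra.subset_adjoin (by simp)⟩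

/-- `J_n = ⟨u - 1, u³v⁴ - 1, uv - 1⟩ ^ (n + 1)`. -/
def idealJ (n : ℕ) : Ideal (toricAlg R) :=
  Ideal.span {genU R - 1, genW R - 1, genT R - 1} ^ (n + 1)

end Generators

/-- The exponent vector of `u ^ a * v ^ b`. -/
def expVec (a b : ℕ) : Fin 2 →₀ ℕ := Finsupp.single 0 a + Finsupp.single 1 b

/-- The semigroup `ℕ((1,0), (3,4), (1,1))` of exponents of the monomials of `R[u, u³v⁴, uv]`. -/
def expSemigroup : AddSubmonoid (Fin 2 →₀ ℕ) :=
  AddSubmonoid.closure {expVec 1 0, expVec 3 4, expVec 1 1}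

/-- `x ^ α` divides `x ^ γ` in `R[u, u³v⁴, uv]`. -/
def MonDvd (α γ : Fin 2 →₀ ℕ) : Prop := ∃ δ ∈ expSemigroup, γ = α + δ

/-- The matrix that defines the monomial order. -/
def orderMatrix : Matrix (Fin 2) (Fin 2) ℤ := !![2, -1; 1, 1]

/-- The monomial order defined by `orderMatrix`: compare the images of the exponents under the
matrix lexicographically. -/
def MonLE (α β : Fin 2 →₀ ℕ) : Prop :=
  toLex (orderMatrix.mulVec fun i => (α i : ℤ)) ≤ toLex (orderMatrix.mulVec fun i => (β i : ℤ))

section Groebner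

variable {K : Type*} [Field K]

/-- `α` is the exponent of the leading monomial of `f` (in particular `f ≠ 0`). -/
def IsLeadingExp (f : toricAlg K) (α : Fin 2 →₀ ℕ) : Prop :=
  α ∈ (f : MvPolynomial (Fin 2) K).support ∧
    ∀ β ∈ (f : MvPolynomial (Fin 2) K).support, MonLE β α

variable (K) in
/-- The ideal of `K[u, u³v⁴, uv]` generated by the monomials with exponents in `S`. -/
def monomialIdeal (S : Set (Fin 2 →₀ ℕ)) : Ideal (toricAlg K) :=
  Ideal.span {m | ∃ α ∈ S, (m : MvPolynomial (Fin 2) K) = monomial α 1}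

/-- The initial ideal of `I`: generated by the leading monomials of the nonzero elements. -/
def initialIdeal (I : Ideal (toricAlg K)) : Ideal (toricAlg K) :=
  monomialIdeal K {α | ∃ f ∈ I, IsLeadingExp f α}

/-- `G` is a reduced marked Gröbner basis of `I`: a finite set of pairs `(g, α)` of an element
`g` of `I` and its leading exponent `α`, whose leading monomials generate the initial ideal, with
leading coefficients `1`, and such that no monomial of an element is divisible by the leading
monomial of another one. -/
structure IsReducedMarkedGB (I : Ideal (toricAlg K))
    (G : Set (toricAlg K × (Fin 2 →₀ ℕ))) : Prop where
  finite : G.Finite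
  mem : ∀ x ∈ G, x.1 ∈ I
  marked : ∀ x ∈ G, IsLeadingExp x.1 x.2
  initial : monomialIdeal K {α | ∃ x ∈ G, x.2 = α} = initialIdeal I
  monic : ∀ x ∈ G, (x.1 : MvPolynomial (Fin 2) K).coeff x.2 = 1
  reduced : ∀ x ∈ G, ∀ y ∈ G, x ≠ y →
    ∀ γ ∈ (y.1 : MvPolynomial (Fin 2) K).support, ¬ MonDvd x.2 γ

end Groebner

/-- `h ∈ ℤ[u, u³v⁴, uv]` is `g ∈ ℂ[u, u³v⁴, uv]`. -/
def IsIntegralForm (g : toricAlg ℂ) (h : toricAlg ℤ) : Prop :=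
  map (Int.castRingHom ℂ) (h : MvPolynomial (Fin 2) ℤ) = (g : MvPolynomial (Fin 2) ℂ)

/-- The reduction of `f ∈ ℤ[u, v]` mod `p`, with coefficients mapped to `K` by `ℤ/p → K`. -/
def reduceMod (p : ℕ) (K : Type*) [Field K] [CharP K p] (f : MvPolynomial (Fin 2) ℤ) :
    MvPolynomial (Fin 2) K :=
  map (ZMod.castHom (dvd_refl p) K) (map (Int.castRingHom (ZMod p)) f)

/-- `G mod p = {(g mod p, α) | (g, α) ∈ G}`, for a set `G` of marked polynomials over `ℂ` whose
polynomials have integer coefficients. -/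
def markedMod (p : ℕ) (K : Type*) [Field K] [CharP K p]
    (G : Set (toricAlg ℂ × (Fin 2 →₀ ℕ))) : Set (toricAlg K × (Fin 2 →₀ ℕ)) :=
  {y | ∃ x ∈ G, ∃ h : toricAlg ℤ, IsIntegralForm x.1 h ∧
    (y.1 : MvPolynomial (Fin 2) K) = reduceMod p K h ∧ y.2 = x.2}

end

end A3

namespace A3

/-! The quotient by `J_n` is governed by integral data independent of the coefficient ring. An
integer-valued function φ on exponents gives the functional x^γ ↦ φ(γ). Multiplication by x^δ - 1
then becomes the difference φ(· + δ) - φ, so functions of degree at most n annihilate `J_n`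
(`pairing_eq_zero_of_mem_pow`). The products of binomial coefficients `dualFun` supply one such
function for each candidate standard monomial, and their matrix of values is triangular with
diagonal entries ±1, hence invertible over ℤ (`isUnit_dualMatrix`). As the quotient is spanned by
equally many elements, these functionals cut out `J_n` over every commutative ring
(`mem_idealJ_iff`).

So normal forms have integer coefficients and commute with base change (`map_reductor`). The
standard monomials form an initial segment of the order, so a nonstandard monomial leads its
difference with its normal form. The differences for the minimal nonstandard monomials are the
unique reduced basis (`isReducedMarkedGB_reductorBasis`, `IsReducedMarkedGB.eq_reductorBasis`). -/

/-! ### The exponent semigroup as a cone. -/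

theorem mem_expSemigroup_iff (γ : Fin 2 →₀ ℕ) : γ ∈ expSemigroup ↔ 3 * γ 1 ≤ 4 * γ 0 := by
  constructor
  · intro h
    induction h using AddSubmonoid.closure_induction with
    | mem x hx => rcases hx with rfl | rfl | rfl <;> simp [expVec]
    | zero => simp
    | add x y _ _ hx hy => simp only [Finsupp.add_apply]; omega
  · intro h
    have hu : expVec 1 0 ∈ expSemigroup := AddSubmonoid.subset_closure (by simp)
    have hw : expVec 3 4 ∈ expSemigroup := AddSubmonoid.subset_closure (by simp)
    have ht : expVec 1 1 ∈ expSemigroup := AddSubmonoid.subset_closure (by simp)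
    -- The ray through (1,1) cuts the cone into two unimodular cones, spanned by (1,1), (3,4) and by
    -- (1,1), (1,0).
    rcases le_total (γ 0) (γ 1) with hab | hab
    · have : γ = (4 * γ 0 - 3 * γ 1) • expVec 1 1 + (γ 1 - γ 0) • expVec 3 4 := by
        ext i
        fin_cases i <;> simp [expVec] <;> omega
      rw [this]
      exact add_mem (nsmul_mem ht _) (nsmul_mem hw _)
    · have : γ = γ 1 • expVec 1 1 + (γ 0 - γ 1) • expVec 1 0 := by
        ext i
        fin_cases i <;> simp [expVec]
        omega
      rw [this]
      exact add_mem (nsmul_mem ht _) (nsmul_mem hu _)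

theorem X_zero_eq (R : Type*) [CommRing R] :
    (X 0 : MvPolynomial (Fin 2) R) = monomial (expVec 1 0) 1 := by
  simp [expVec, X]

theorem X_zero_pow_mul_X_one_pow (R : Type*) [CommRing R] (a b : ℕ) :
    (X 0 ^ a * X 1 ^ b : MvPolynomial (Fin 2) R) = monomial (expVec a b) 1 := by
  simp [expVec, X_pow_eq_monomial, monomial_mul]

theorem monomial_mem_toricAlg {R : Type*} [CommRing R] {γ : Fin 2 →₀ ℕ} (hγ : γ ∈ expSemigroup)
    (r : R) : monomial γ r ∈ toricAlg R := by
  suffices h : monomial γ (1 : R) ∈ toricAlg R by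
    simpa [smul_monomial] using (toricAlg R).smul_mem h r
  induction hγ using AddSubmonoid.closure_induction with
  | mem x hx =>
    rcases hx with rfl | rfl | rfl
    · rw [← X_zero_pow_mul_X_one_pow]
      exact Algebra.subset_adjoin (by simp)
    · rw [← X_zero_pow_mul_X_one_pow]
      exact Algebra.subset_adjoin (by simp)
    · rw [← X_zero_pow_mul_X_one_pow]
      exact Algebra.subset_adjoin (by simp)
  | zero => exact one_mem _
  | add x y _ _ hx hy => simpa [monomial_mul] using mul_mem hx hy

/-- The algebra `R[u, u³v⁴, uv]` is the semigroup algebra of `expSemigroup`. -/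
theorem mem_toricAlg_iff {R : Type*} [CommRing R] {f : MvPolynomial (Fin 2) R} :
    f ∈ toricAlg R ↔ ∀ γ ∈ f.support, γ ∈ expSemigroup := by
  classical
  constructor
  · intro hf
    induction hf using Algebra.adjoin_induction with
    | mem x hx =>
      intro γ hγ
      obtain ⟨a, b, hx, hab⟩ : ∃ a b, x = monomial (expVec a b) 1 ∧ 3 * b ≤ 4 * a := by
        rcases hx with rfl | rfl | rfl
        · exact ⟨1, 0, by rw [X_zero_eq], by simp⟩
        · exact ⟨3, 4, by rw [X_zero_pow_mul_X_one_pow], by simp⟩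
        · exact ⟨1, 1, by rw [← X_zero_pow_mul_X_one_pow, pow_one, pow_one], by simp⟩
      subst hx
      have := support_monomial_subset hγ
      rw [Finset.mem_singleton] at this
      rw [this, mem_expSemigroup_iff]
      simpa [expVec] using hab
    | algebraMap r =>
      intro γ hγ
      rw [algebraMap_eq, C_apply] at hγ
      have := support_monomial_subset hγ
      rw [Finset.mem_singleton] at this
      exact this ▸ zero_mem _
    | add x y _ _ hx hy =>
      intro γ hγ
      rcases Finset.mem_union.1 (support_add hγ) with h | h
      exacts [hx _ h, hy _ h]
    | mul x y _ _ hx hy =>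
      intro γ hγ
      obtain ⟨a, ha, b, hb, rfl⟩ := Finset.mem_add.1 (support_mul _ _ hγ)
      exact add_mem (hx _ ha) (hy _ hb)
  · intro h
    rw [f.as_sum]
    exact sum_mem fun γ hγ => monomial_mem_toricAlg (h γ hγ) _

/-! ### Polynomial functions of bounded degree: `diffKer M (d + 1)` means degree at most d. -/

/-- Functions on `M` that are annihilated by all `d`-fold differences. -/
def diffKer (M : Type*) [AddCommMonoid M] : ℕ → AddSubgroup (M → ℤ)
  | 0 => ⊥
  | d + 1 =>
    { carrier := {φ | ∀ δ, fwdDiff δ φ ∈ diffKer M d}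
      zero_mem' := fun δ => by
        convert zero_mem (diffKer M d)
        ext
        simp [fwdDiff]
      add_mem' := fun {φ ψ} hφ hψ δ => by
        rw [fwdDiff_add]
        exact add_mem (hφ δ) (hψ δ)
      neg_mem' := fun {φ} hφ δ => by
        convert neg_mem (hφ δ)
        ext
        simp [fwdDiff]
        ring }

section diffKer

variable {M : Type*} [AddCommMonoid M]

theorem mem_diffKer_zero {φ : M → ℤ} : φ ∈ diffKer M 0 ↔ φ = 0 := Iff.rfl

theorem diffKer_mono {d e : ℕ} (h : d ≤ e) : diffKer M d ≤ diffKer M e := by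
  have step : ∀ d, diffKer M d ≤ diffKer M (d + 1) := by
    intro d
    induction d with
    | zero =>
      intro φ hφ
      rw [mem_diffKer_zero.1 hφ]
      exact zero_mem _
    | succ d ih => exact fun φ hφ δ => ih (hφ δ)
  exact monotone_nat_of_le_succ step h

theorem shift_mem_diffKer {d : ℕ} {φ : M → ℤ} (hφ : φ ∈ diffKer M d) (δ : M) :
    (fun γ => φ (γ + δ)) ∈ diffKer M d := by
  induction d generalizing φ with
  | zero =>
    rw [mem_diffKer_zero.1 hφ]
    exact zero_mem _
  | succ d ih =>
    intro ε
    convert ih (hφ ε) using 1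
    ext γ
    simp [fwdDiff, add_right_comm]

/-- Degrees add, by induction with the discrete Leibniz rule. -/
theorem mul_mem_diffKer {d e : ℕ} {φ ψ : M → ℤ} (hφ : φ ∈ diffKer M (d + 1))
    (hψ : ψ ∈ diffKer M (e + 1)) : φ * ψ ∈ diffKer M (d + e + 1) := by
  induction hk : d + e generalizing d e φ ψ with
  | zero =>
    obtain ⟨rfl, rfl⟩ : d = 0 ∧ e = 0 := by omega
    intro δ
    have h1 := hφ δ
    have h2 := hψ δ
    rw [mem_diffKer_zero] at h1 h2 ⊢
    ext γ
    have h1 := congrFun h1 γ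
    have h2 := congrFun h2 γ
    simp only [fwdDiff, Pi.mul_apply, Pi.zero_apply, sub_eq_zero] at h1 h2 ⊢
    rw [h1, h2]
  | succ k ih =>
    intro δ
    have : fwdDiff δ (φ * ψ) = (fun γ => φ (γ + δ)) * fwdDiff δ ψ + fwdDiff δ φ * ψ := by
      ext γ
      simp only [fwdDiff, Pi.mul_apply, Pi.add_apply]
      ring
    rw [this]
    refine add_mem ?_ ?_
    · cases e with
      | zero =>
        rw [mem_diffKer_zero.1 (hψ δ), mul_zero]
        exact zero_mem _
      | succ e => exact ih (shift_mem_diffKer hφ δ) (hψ δ) (by omega)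
    · cases d with
      | zero =>
        rw [mem_diffKer_zero.1 (hφ δ), zero_mul]
        exact zero_mem _
      | succ d => exact ih (hφ δ) hψ (by omega)

theorem comp_mem_diffKer {N : Type*} [AddCommMonoid N] (g : M →+ N) {d : ℕ} {φ : N → ℤ}
    (hφ : φ ∈ diffKer N d) : φ ∘ g ∈ diffKer M d := by
  induction d generalizing φ with
  | zero =>
    rw [mem_diffKer_zero.1 hφ]
    exact zero_mem _
  | succ d ih =>
    intro δ
    convert ih (hφ (g δ)) using 1
    ext γ
    simp [fwdDiff]

/-- By Vandermonde, a difference of `choose x m` is an integral combination of the `choose x i` with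
i < m. -/
theorem choose_mem_diffKer (m : ℕ) : (fun x : ℤ => Ring.choose x m) ∈ diffKer ℤ (m + 1) := by
  induction m using Nat.strong_induction_on with
  | _ m ih =>
    intro δ
    have : fwdDiff δ (fun x : ℤ => Ring.choose x m) =
        ∑ ij ∈ (Finset.HasAntidiagonal.antidiagonal m).erase (m, 0),
          Ring.choose δ ij.2 • fun x : ℤ => Ring.choose x ij.1 := by
      ext x
      rw [fwdDiff, Ring.add_choose_eq _ (Commute.all _ _),
        ← Finset.add_sum_erase _ _ (by simp : (m, 0) ∈ Finset.HasAntidiagonal.antidiagonal m)]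
      simp [mul_comm]
    rw [this]
    refine sum_mem fun ij hij => zsmul_mem ?_ _
    have h1 : ij.1 + ij.2 = m := Finset.HasAntidiagonal.mem_antidiagonal.1 (Finset.mem_of_mem_erase hij)
    have h2 : ij.1 < m := by
      refine lt_of_le_of_ne (by omega) fun h => Finset.ne_of_mem_erase hij ?_
      ext
      · exact h
      · change ij.2 = 0
        omega
    exact diffKer_mono h2 (ih _ h2)

end diffKer

/-! ### Standard exponents and the dual integer-valued functions. -/

/-- The exponent of `t ^ j * w ^ (m / 2)` if `m` is even and of `t ^ j * u ^ ((m + 1) / 2)` if `m`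
is odd, where `w = u³v⁴` and `t = uv`; every element of `expSemigroup` has this form for exactly
one pair `x = (m, j)`. -/
noncomputable def stdExp (x : ℕ × ℕ) : Fin 2 →₀ ℕ :=
  if x.1 % 2 = 0 then expVec (x.2 + 3 * (x.1 / 2)) (x.2 + 4 * (x.1 / 2))
  else expVec (x.2 + (x.1 + 1) / 2) x.2

theorem expVec_zero (a b : ℕ) : expVec a b 0 = a := by simp [expVec]

theorem expVec_one (a b : ℕ) : expVec a b 1 = b := by simp [expVec]

theorem stdExp_zero (x : ℕ × ℕ) :
    stdExp x 0 = if x.1 % 2 = 0 then x.2 + 3 * (x.1 / 2) else x.2 + (x.1 + 1) / 2 := by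
  unfold stdExp
  split_ifs <;> rw [expVec_zero]

theorem stdExp_one (x : ℕ × ℕ) :
    stdExp x 1 = if x.1 % 2 = 0 then x.2 + 4 * (x.1 / 2) else x.2 := by
  unfold stdExp
  split_ifs <;> rw [expVec_one]

theorem stdExp_injective : Function.Injective stdExp := by
  intro x y h
  have h0 := congrArg (· 0) h
  have h1 := congrArg (· 1) h
  simp only [stdExp_zero, stdExp_one] at h0 h1
  ext
  · split_ifs at h0 h1 <;> omega
  · split_ifs at h0 h1 <;> omega

theorem stdExp_mem (x : ℕ × ℕ) : stdExp x ∈ expSemigroup := by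
  rw [mem_expSemigroup_iff, stdExp_zero, stdExp_one]
  split_ifs <;> omega

theorem exists_stdExp_eq {γ : Fin 2 →₀ ℕ} (hγ : γ ∈ expSemigroup) : ∃ x, stdExp x = γ := by
  rw [mem_expSemigroup_iff] at hγ
  -- The sign and size of γ₁ - γ₀ determine m; it equals m/2 for even m and -(m+1)/2 for odd m.
  refine ⟨if γ 0 ≤ γ 1 then (2 * (γ 1 - γ 0), 4 * γ 0 - 3 * γ 1)
    else (2 * (γ 0 - γ 1) - 1, γ 1), ?_⟩
  ext i
  fin_cases i
  · simp only [Fin.zero_eta, stdExp_zero]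
    split_ifs <;> simp only at * <;> omega
  · simp only [Fin.mk_one, stdExp_one]
    split_ifs <;> simp only at * <;> omega

theorem choose_eq_zero {x : ℤ} {m : ℕ} (h0 : 0 ≤ x) (h1 : x < m) : Ring.choose x m = 0 := by
  lift x to ℕ using h0
  rw [Ring.choose_natCast, Nat.choose_eq_zero_of_lt (by exact_mod_cast h1), Nat.cast_zero]

theorem choose_self (m : ℕ) : Ring.choose (m : ℤ) m = 1 := by
  rw [Ring.choose_natCast, Nat.choose_self, Nat.cast_one]

theorem isUnit_choose_neg_one (m : ℕ) : IsUnit (Ring.choose (-1 : ℤ) m) := by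
  rw [Ring.choose_neg, add_sub_cancel_left, choose_self, Units.smul_def, smul_eq_mul, mul_one]
  exact Units.isUnit _

/-- Integer valued functions of degree `m + j` on the exponents, unitriangular with respect to
`stdExp`. -/
def dualFun (x : ℕ × ℕ) (γ : Fin 2 →₀ ℕ) : ℤ :=
  Ring.choose ((γ 1 : ℤ) - γ 0 + (x.1 / 2 : ℕ)) x.1 *
    Ring.choose (2 * (γ 0 : ℤ) - γ 1 + -(2 * ((x.1 + 1) / 2) : ℕ)) x.2

theorem dualFun_mem_diffKer (x : ℕ × ℕ) :
    dualFun x ∈ diffKer (Fin 2 →₀ ℕ) (x.1 + x.2 + 1) := by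
  let e (i : Fin 2) : (Fin 2 →₀ ℕ) →+ ℤ := (Nat.castAddMonoidHom ℤ).comp (Finsupp.applyAddHom i)
  have h1 := comp_mem_diffKer (e 1 - e 0)
    (shift_mem_diffKer (choose_mem_diffKer x.1) (x.1 / 2 : ℕ))
  have h2 := comp_mem_diffKer (2 • e 0 - e 1)
    (shift_mem_diffKer (choose_mem_diffKer x.2) (-(2 * ((x.1 + 1) / 2) : ℕ)))
  convert mul_mem_diffKer h1 h2 using 1
  ext γ
  simp [dualFun, e]

/-- On `stdExp (m, j)` the difference γ₁ - γ₀ runs through 0, -1, 1, -2, 2, … as m grows. The shift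
by `x.1 / 2` moves the values for smaller m into [0, `x.1`), where the first binomial vanishes. -/
theorem dualFun_stdExp_of_fst_lt {x y : ℕ × ℕ} (h : y.1 < x.1) : dualFun x (stdExp y) = 0 := by
  rw [dualFun, choose_eq_zero, zero_mul] <;>
  · rw [stdExp_zero, stdExp_one]
    split_ifs <;> push_cast <;> omega

/-- On `stdExp (m, j)` one has 2γ₀ - γ₁ = j + 2⌈m/2⌉, so the second binomial is evaluated at j. -/
theorem dualFun_stdExp_of_snd_lt {x y : ℕ × ℕ} (h : y.1 = x.1) (h' : y.2 < x.2) :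
    dualFun x (stdExp y) = 0 := by
  rw [dualFun, mul_comm, choose_eq_zero, zero_mul] <;>
  · rw [stdExp_zero, stdExp_one]
    split_ifs <;> push_cast <;> omega

theorem isUnit_dualFun_stdExp_self (x : ℕ × ℕ) : IsUnit (dualFun x (stdExp x)) := by
  have h2 : (2 * (stdExp x 0 : ℤ) - stdExp x 1 + -(2 * ((x.1 + 1) / 2) : ℕ)) = (x.2 : ℕ) := by
    rw [stdExp_zero, stdExp_one]
    split_ifs <;> push_cast <;> omega
  rw [dualFun, h2, choose_self, mul_one]
  -- The first binomial is evaluated at m for even m, just above its zeros, and at -1 for odd m,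
  -- just below them.
  rcases Nat.mod_two_eq_zero_or_one x.1 with h | h
  · have h1 : (stdExp x 1 : ℤ) - stdExp x 0 + (x.1 / 2 : ℕ) = (x.1 : ℕ) := by
      rw [stdExp_zero, stdExp_one, if_pos h, if_pos h]
      push_cast
      omega
    rw [h1, choose_self]
    exact isUnit_one
  · have h1 : (stdExp x 1 : ℤ) - stdExp x 0 + (x.1 / 2 : ℕ) = -1 := by
      rw [stdExp_zero, stdExp_one, if_neg (by omega), if_neg (by omega)]
      push_cast
      omega
    rw [h1]
    exact isUnit_choose_neg_one _

/-- Index set of the standard monomials of `J_n`, ordered lexicographically. -/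
abbrev StdIndex (n : ℕ) : Type := {x : ℕ ×ₗ ℕ // (ofLex x).1 + (ofLex x).2 ≤ n}

instance (n : ℕ) : Finite (StdIndex n) := by
  refine Finite.of_injective
    (β := Fin (n + 1) × Fin (n + 1))
    (fun x => (⟨(ofLex x.1).1, by have := x.2; omega⟩, ⟨(ofLex x.1).2, by have := x.2; omega⟩)) ?_
  intro x y h
  simp only [Prod.mk.injEq, Fin.mk.injEq] at h
  exact Subtype.ext (ofLex.injective (Prod.ext h.1 h.2))

noncomputable instance (n : ℕ) : Fintype (StdIndex n) := Fintype.ofFinite _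

/-- The exponents of the standard monomials of `J_n`. -/
noncomputable def stdMon {n : ℕ} (i : StdIndex n) : Fin 2 →₀ ℕ := stdExp (ofLex i.1)

theorem stdMon_injective (n : ℕ) : Function.Injective (stdMon (n := n)) :=
  fun _ _ h => Subtype.ext (ofLex.injective (stdExp_injective h))

theorem stdMon_mem {n : ℕ} (i : StdIndex n) : stdMon i ∈ expSemigroup := stdExp_mem _

/-- The values of the functions `dualFun` at the standard monomials. -/
noncomputable def dualMatrix (n : ℕ) : Matrix (StdIndex n) (StdIndex n) ℤ :=
  Matrix.of fun i k => dualFun (ofLex i.1) (stdMon k)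

theorem isUnit_dualMatrix (n : ℕ) : IsUnit (dualMatrix n) := by
  rw [Matrix.isUnit_iff_isUnit_det, Matrix.det_of_isUpperTriangular]
  · exact IsUnit.prod_univ_iff.2 fun i => isUnit_dualFun_stdExp_self _
  · intro i k hik
    rcases Prod.Lex.lt_iff.1 (show k.1 < i.1 from hik) with h | ⟨h, h'⟩
    · exact dualFun_stdExp_of_fst_lt h
    · exact dualFun_stdExp_of_snd_lt h h'

/-- The coefficients of the normal form modulo `J_n` of the monomial with exponent `γ`. -/
noncomputable def normalCoeff (n : ℕ) (γ : Fin 2 →₀ ℕ) : StdIndex n → ℤ :=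
  ((dualMatrix n)⁻¹).mulVec fun i => dualFun (ofLex i.1) γ

theorem dualMatrix_mulVec_normalCoeff (n : ℕ) (γ : Fin 2 →₀ ℕ) :
    (dualMatrix n).mulVec (normalCoeff n γ) = fun i => dualFun (ofLex i.1) γ := by
  rw [normalCoeff, Matrix.mulVec_mulVec, Matrix.mul_nonsing_inv, Matrix.one_mulVec]
  exact (Matrix.isUnit_iff_isUnit_det _).1 (isUnit_dualMatrix n)

/-! ### Functionals that annihilate powers of the ideal. -/

section Pairing

variable (R : Type*) [CommRing R]

/-- The linear functional on polynomials with value `φ γ` at the monomial with exponent `γ`. -/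
noncomputable def pairing (φ : (Fin 2 →₀ ℕ) → ℤ) : MvPolynomial (Fin 2) R →ₗ[R] R :=
  (basisMonomials (Fin 2) R).constr R fun γ => (φ γ : R)

variable {R}

theorem pairing_monomial (φ : (Fin 2 →₀ ℕ) → ℤ) (γ : Fin 2 →₀ ℕ) (r : R) :
    pairing R φ (monomial γ r) = r * φ γ := by
  have h := (basisMonomials (Fin 2) R).constr_basis R (fun γ => (φ γ : R)) γ
  rw [coe_basisMonomials] at h
  have hr : monomial γ r = r • monomial γ (1 : R) := by simp [smul_monomial]
  rw [hr, map_smul, pairing, h, smul_eq_mul]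

theorem pairing_sub_one_mul (φ : (Fin 2 →₀ ℕ) → ℤ) (δ : Fin 2 →₀ ℕ) (f : MvPolynomial (Fin 2) R) :
    pairing R φ ((monomial δ 1 - 1) * f) = pairing R (fwdDiff δ φ) f := by
  have : pairing R φ ∘ₗ LinearMap.mulLeft R (monomial δ 1 - 1) = pairing R (fwdDiff δ φ) := by
    refine (basisMonomials (Fin 2) R).ext fun γ => ?_
    simp only [coe_basisMonomials, LinearMap.comp_apply, LinearMap.mulLeft_apply, sub_mul,
      monomial_mul, one_mul, map_sub, pairing_monomial, fwdDiff]
    rw [add_comm δ γ]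
    push_cast
    rfl
  exact DFunLike.congr_fun this f

theorem coe_generator_eq {x : toricAlg R} (hx : x ∈ ({genU R - 1, genW R - 1, genT R - 1} : Set _)) :
    ∃ δ, (x : MvPolynomial (Fin 2) R) = monomial δ 1 - 1 := by
  rcases hx with rfl | rfl | rfl
  · exact ⟨expVec 1 0, by rw [← X_zero_eq]; rfl⟩
  · exact ⟨expVec 3 4, by rw [← X_zero_pow_mul_X_one_pow]; rfl⟩
  · exact ⟨expVec 1 1, by rw [← X_zero_pow_mul_X_one_pow, pow_one, pow_one]; rfl⟩

theorem pairing_eq_zero_of_mem_pow {d : ℕ} {φ : (Fin 2 →₀ ℕ) → ℤ} (hφ : φ ∈ diffKer _ d)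
    {f : toricAlg R} (hf : f ∈ Ideal.span {genU R - 1, genW R - 1, genT R - 1} ^ d) :
    pairing R φ f = 0 := by
  induction d generalizing φ f with
  | zero =>
    rw [mem_diffKer_zero.1 hφ]
    have : pairing R 0 = 0 := by
      refine (basisMonomials (Fin 2) R).ext fun γ => ?_
      simp [pairing_monomial]
    rw [this, LinearMap.zero_apply]
  | succ d ih =>
    rw [pow_succ'] at hf
    induction hf using Submodule.mul_induction_on' with
    | mem_mul_mem a ha b hb =>
      induction ha using Submodule.span_induction generalizing b with
      | mem x hx =>
        obtain ⟨δ, hδ⟩ := coe_generator_eq hx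
        rw [MulMemClass.coe_mul, hδ, pairing_sub_one_mul]
        exact ih (hφ δ) hb
      | zero => simp
      | add x y _ _ hx hy =>
        rw [add_mul, AddMemClass.coe_add, map_add, hx b hb, hy b hb, add_zero]
      | smul r x _ hx =>
        -- The scalar moves into the second factor, which is why the induction is uniform in `b`.
        rw [smul_eq_mul, mul_comm r x, mul_assoc]
        exact hx _ (Ideal.mul_mem_left _ r hb)
    | add x _ y _ hx hy => rw [AddMemClass.coe_add, map_add, hx, hy, add_zero]

theorem pairing_dualFun_eq_zero {n : ℕ} {f : toricAlg R} (hf : f ∈ idealJ R n) (i : StdIndex n) :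
    pairing R (dualFun (ofLex i.1)) f = 0 :=
  pairing_eq_zero_of_mem_pow
    (diffKer_mono (Nat.succ_le_succ i.2) (dualFun_mem_diffKer _)) hf

end Pairing

/-! ### Spanning modulo `J_n`, membership and integral normal forms. -/

section Spanning

variable {R : Type*} [CommRing R]

theorem genU_mul_genW (R : Type*) [CommRing R] : genU R * genW R = genT R ^ 4 := by
  ext1
  change (X 0 * (X 0 ^ 3 * X 1 ^ 4) : MvPolynomial (Fin 2) R) = (X 0 * X 1) ^ 4
  ring

theorem one_sub_genU_pow_mem_idealJ (R : Type*) [CommRing R] (n : ℕ) :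
    (1 - genU R) ^ (n + 1) ∈ idealJ R n := by
  have h : genU R - 1 ∈ Ideal.span {genU R - 1, genW R - 1, genT R - 1} :=
    Ideal.subset_span (by simp)
  exact Ideal.pow_mem_pow (by simpa only [neg_sub] using neg_mem h) _

/-- Modulo `J_n`, every element is a polynomial in `u - 1` and `t - 1`. -/
theorem exists_sub_aeval_mem_idealJ (n : ℕ) (f : toricAlg R) :
    ∃ p : MvPolynomial (Fin 2) R, f - aeval ![genU R - 1, genT R - 1] p ∈ idealJ R n := by
  set q := Ideal.Quotient.mkₐ R (idealJ R n) with hq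
  set S := (q.comp (aeval ![genU R - 1, genT R - 1])).range with hS
  suffices h : q f ∈ S by
    obtain ⟨p, hp⟩ := h
    exact ⟨p, (Ideal.Quotient.eq).1 hp.symm⟩
  have hmem (i : Fin 2) : q (![genU R - 1, genT R - 1] i) ∈ S := ⟨X i, by simp⟩
  have hu : q (genU R) ∈ S := by
    have := add_mem (hmem 0) (one_mem S)
    rwa [← map_one q, ← map_add, Matrix.cons_val_zero, sub_add_cancel] at this
  have ht : q (genT R) ∈ S := by
    have := add_mem (hmem 1) (one_mem S)
    rwa [← map_one q, ← map_add, Matrix.cons_val_one, Matrix.cons_val_fin_one,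
      sub_add_cancel] at this
  have hw : q (genW R) ∈ S := by
    -- Modulo `J_n` the element 1 - u is nilpotent, so the truncated geometric series inverts u, and
    -- uw = t⁴ eliminates w.
    set v := ∑ i ∈ Finset.range (n + 1), (1 - q (genU R)) ^ i with hv
    have hvS : v ∈ S := sum_mem fun i _ => pow_mem (sub_mem (one_mem S) hu) _
    have huv : v * q (genU R) = 1 := by
      have h0 : (1 - q (genU R)) ^ (n + 1) = 0 := by
        rw [← map_one q, ← map_sub, ← map_pow]
        exact Ideal.Quotient.eq_zero_iff_mem.2 (one_sub_genU_pow_mem_idealJ R n)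
      have := geom_sum_mul_neg (1 - q (genU R)) (n + 1)
      rwa [h0, sub_sub_cancel, sub_zero] at this
    have : q (genW R) = v * q (genT R) ^ 4 := by
      rw [← map_pow, ← genU_mul_genW, map_mul, ← mul_assoc, huv, one_mul]
    rw [this]
    exact mul_mem hvS (pow_mem ht _)
  obtain ⟨f, hf⟩ := f
  induction hf using Algebra.adjoin_induction with
  | mem x hx =>
    rcases hx with rfl | rfl | rfl
    exacts [hu, hw, ht]
  | algebraMap r => exact S.algebraMap_mem r
  | add x y hx hy h1 h2 =>
    have : (⟨x + y, add_mem hx hy⟩ : toricAlg R) = ⟨x, hx⟩ + ⟨y, hy⟩ := rfl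
    rw [this, map_add]
    exact add_mem h1 h2
  | mul x y hx hy h1 h2 =>
    have : (⟨x * y, mul_mem hx hy⟩ : toricAlg R) = ⟨x, hx⟩ * ⟨y, hy⟩ := rfl
    rw [this, map_mul]
    exact mul_mem h1 h2

/-- The linear combination of the products `(u - 1) ^ i * (t - 1) ^ j` with `i + j ≤ n` and given
coefficients. -/
noncomputable def taylorComb (R : Type*) [CommRing R] (n : ℕ) : (StdIndex n → R) →ₗ[R] toricAlg R :=
  Fintype.linearCombination R
    fun i : StdIndex n => (genU R - 1) ^ (ofLex i.1).1 * (genT R - 1) ^ (ofLex i.1).2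

theorem exists_sub_taylorComb_mem_idealJ (n : ℕ) (f : toricAlg R) :
    ∃ c, f - taylorComb R n c ∈ idealJ R n := by
  obtain ⟨p, hp⟩ := exists_sub_aeval_mem_idealJ n f
  suffices h : ∃ c, aeval ![genU R - 1, genT R - 1] p - taylorComb R n c ∈ idealJ R n by
    obtain ⟨c, hc⟩ := h
    exact ⟨c, by simpa using add_mem hp hc⟩
  clear hp
  induction p using MvPolynomial.induction_on' with
  | monomial γ r =>
    by_cases hγ : γ 0 + γ 1 ≤ n
    · refine ⟨Pi.single ⟨toLex (γ 0, γ 1), hγ⟩ r, ?_⟩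
      convert zero_mem (idealJ R n)
      rw [taylorComb, Fintype.linearCombination_apply_single, aeval_monomial,
        Finsupp.prod_fintype _ _ (by simp), Fin.prod_univ_two, Algebra.smul_def]
      simp
    · refine ⟨0, ?_⟩
      rw [map_zero, sub_zero, aeval_monomial, Finsupp.prod_fintype _ _ (by simp), Fin.prod_univ_two]
      refine Ideal.mul_mem_left _ _ (Ideal.pow_le_pow_right (show n + 1 ≤ γ 0 + γ 1 by omega) ?_)
      rw [pow_add]
      exact Ideal.mul_mem_mul (Ideal.pow_mem_pow (Ideal.subset_span (by simp)) _)
        (Ideal.pow_mem_pow (Ideal.subset_span (by simp)) _)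
  | add p q hp hq =>
    obtain ⟨c, hc⟩ := hp
    obtain ⟨d, hd⟩ := hq
    refine ⟨c + d, ?_⟩
    rw [map_add, map_add, add_sub_add_comm]
    exact add_mem hc hd

/-- The monomials of `R[u, u³v⁴, uv]`. -/
noncomputable def toricMonomial (γ : Fin 2 →₀ ℕ) (hγ : γ ∈ expSemigroup) (r : R) : toricAlg R :=
  ⟨monomial γ r, monomial_mem_toricAlg hγ r⟩

/-- The linear combination of the standard monomials of `J_n` with given coefficients. -/
noncomputable def stdComb {n : ℕ} (c : StdIndex n → R) : toricAlg R :=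
  ∑ k, toricMonomial (stdMon k) (stdMon_mem k) (c k)

theorem coe_stdComb {n : ℕ} (c : StdIndex n → R) :
    (stdComb c : MvPolynomial (Fin 2) R) = ∑ k, monomial (stdMon k) (c k) := by
  rw [stdComb, AddSubmonoidClass.coe_finsetSum]
  rfl

variable (R) in
/-- The values of the functionals given by `dualFun`. -/
noncomputable def dualEval (n : ℕ) : toricAlg R →ₗ[R] (StdIndex n → R) :=
  LinearMap.pi fun i => pairing R (dualFun (ofLex i.1)) ∘ₗ (toricAlg R).val.toLinearMap

theorem dualEval_apply (n : ℕ) (f : toricAlg R) (i : StdIndex n) :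
    dualEval R n f i = pairing R (dualFun (ofLex i.1)) f := rfl

theorem dualEval_stdComb {n : ℕ} (c : StdIndex n → R) :
    dualEval R n (stdComb c) = ((dualMatrix n).map (Int.castRingHom R)).mulVec c := by
  ext i
  rw [dualEval_apply, coe_stdComb, map_sum, Matrix.mulVec, dotProduct]
  refine Finset.sum_congr rfl fun k _ => ?_
  rw [pairing_monomial, mul_comm]
  rfl

variable (R) in
theorem isUnit_dualMatrix_map (n : ℕ) : IsUnit ((dualMatrix n).map (Int.castRingHom R)) :=
  (isUnit_dualMatrix n).map (Int.castRingHom R).mapMatrix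

theorem dualEval_eq_zero {n : ℕ} {f : toricAlg R} (hf : f ∈ idealJ R n) : dualEval R n f = 0 :=
  funext fun i => pairing_dualFun_eq_zero hf i

/-- The ideal `J_n` is cut out by the functionals given by `dualFun`. -/
theorem mem_idealJ_iff {n : ℕ} {f : toricAlg R} : f ∈ idealJ R n ↔ dualEval R n f = 0 := by
  refine ⟨dualEval_eq_zero, fun h => ?_⟩
  have hc (f : toricAlg R) : ∃ c, f - taylorComb R n c ∈ idealJ R n ∧
      dualEval R n (taylorComb R n c) = dualEval R n f := by
    obtain ⟨c, hc⟩ := exists_sub_taylorComb_mem_idealJ n f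
    refine ⟨c, hc, ?_⟩
    have := dualEval_eq_zero hc
    rw [map_sub, sub_eq_zero] at this
    exact this.symm
  -- The standard monomials already reach every vector of values. A surjective endomorphism of a
  -- finite free module is injective, so the Taylor coefficients of `f` vanish.
  have hsurj : Function.Surjective (dualEval R n ∘ₗ taylorComb R n) := by
    intro v
    obtain ⟨d, hd⟩ := Matrix.mulVec_surjective_iff_isUnit.2 (isUnit_dualMatrix_map R n) v
    obtain ⟨c, -, hc⟩ := hc (stdComb d)
    exact ⟨c, by rw [LinearMap.comp_apply, hc, dualEval_stdComb, hd]⟩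
  obtain ⟨c, hc, hc'⟩ := hc f
  have : c = 0 := OrzechProperty.injective_of_surjective_endomorphism _ hsurj
    (by rw [LinearMap.comp_apply, hc', h, map_zero])
  simpa [this] using hc

/-- The standard monomials of `J_n` are linearly independent modulo `J_n`. -/
theorem eq_zero_of_mem_idealJ [Nontrivial R] {n : ℕ} {f : toricAlg R} (hf : f ∈ idealJ R n)
    (h : ∀ γ ∈ (f : MvPolynomial (Fin 2) R).support, γ ∈ Set.range (stdMon (n := n))) : f = 0 := by
  classical
  set c : StdIndex n → R := fun k => (f : MvPolynomial (Fin 2) R).coeff (stdMon k) with hc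
  have hfc : f = stdComb c := by
    ext γ
    rw [coe_stdComb, coeff_sum]
    simp only [coeff_monomial]
    by_cases hγ : γ ∈ Set.range (stdMon (n := n))
    · obtain ⟨k, rfl⟩ := hγ
      rw [Finset.sum_eq_single k (fun l _ hl => if_neg fun h => hl (stdMon_injective n h))
        (fun hk => absurd (Finset.mem_univ k) hk), if_pos rfl]
    · rw [notMem_support_iff.1 fun h' => hγ (h γ h'),
        Finset.sum_eq_zero fun k _ => if_neg fun h' => hγ ⟨k, h'⟩]
  have h0 : c = 0 := by
    have := dualEval_eq_zero hf
    rw [hfc, dualEval_stdComb] at this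
    exact Matrix.mulVec_injective_of_isUnit (isUnit_dualMatrix_map R n)
      (by rw [this, Matrix.mulVec_zero])
  rw [hfc, h0]
  ext1
  rw [coe_stdComb]
  simp

/-- The monomial with exponent `γ` minus its normal form modulo `J_n`. -/
noncomputable def reductor (R : Type*) [CommRing R] (n : ℕ) (γ : Fin 2 →₀ ℕ)
    (hγ : γ ∈ expSemigroup) : toricAlg R :=
  toricMonomial γ hγ 1 - stdComb fun k => (normalCoeff n γ k : R)

theorem coe_reductor (n : ℕ) (γ : Fin 2 →₀ ℕ) (hγ : γ ∈ expSemigroup) :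
    (reductor R n γ hγ : MvPolynomial (Fin 2) R) =
      monomial γ 1 - ∑ k, monomial (stdMon k) (normalCoeff n γ k : R) := by
  rw [reductor, AddSubgroupClass.coe_sub, coe_stdComb]
  rfl

theorem map_reductor {R' : Type*} [CommRing R'] (g : R →+* R') (n : ℕ) (γ : Fin 2 →₀ ℕ)
    (hγ : γ ∈ expSemigroup) :
    map g (reductor R n γ hγ : MvPolynomial (Fin 2) R) = reductor R' n γ hγ := by
  simp [coe_reductor, map_monomial]

theorem reductor_mem_idealJ (n : ℕ) (γ : Fin 2 →₀ ℕ) (hγ : γ ∈ expSemigroup) :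
    reductor R n γ hγ ∈ idealJ R n := by
  rw [mem_idealJ_iff, reductor, map_sub, dualEval_stdComb, sub_eq_zero]
  ext i
  have h := congrFun (dualMatrix_mulVec_normalCoeff n γ) i
  rw [dualEval_apply, toricMonomial, pairing_monomial, one_mul, ← h]
  simp [Matrix.mulVec, dotProduct]

theorem coeff_reductor_of_notMem {n : ℕ} {γ : Fin 2 →₀ ℕ} (hγ : γ ∈ expSemigroup)
    {δ : Fin 2 →₀ ℕ} (hδ : δ ∉ Set.range (stdMon (n := n))) :
    (reductor R n γ hγ : MvPolynomial (Fin 2) R).coeff δ = if γ = δ then 1 else 0 := by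
  classical
  rw [coe_reductor, coeff_sub, coeff_sum, coeff_monomial]
  simp only [coeff_monomial]
  rw [Finset.sum_eq_zero fun k _ => if_neg fun h => hδ ⟨k, h⟩, sub_zero]

end Spanning

/-! ### The monomial order and nonstandard exponents. -/

theorem monLE_iff {α β : Fin 2 →₀ ℕ} :
    MonLE α β ↔ 2 * (α 0 : ℤ) - α 1 < 2 * β 0 - β 1 ∨
      2 * (α 0 : ℤ) - α 1 = 2 * β 0 - β 1 ∧ α 0 + α 1 ≤ β 0 + β 1 := by
  have h (v w : Fin 2 → ℤ) :
      toLex v ≤ toLex w ↔ v 0 < w 0 ∨ v 0 = w 0 ∧ v 1 ≤ w 1 := by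
    rw [le_iff_lt_or_eq]
    change (∃ i, (∀ j < i, v j = w j) ∧ v i < w i) ∨ _ ↔ _
    rw [Fin.exists_fin_two, toLex_inj, funext_iff, Fin.forall_fin_two,
      Fin.forall_fin_two]
    simp
    omega
  rw [MonLE, h]
  simp [orderMatrix, Matrix.mulVec, dotProduct, Fin.sum_univ_two]
  omega

theorem MonLE.refl (α : Fin 2 →₀ ℕ) : MonLE α α := le_refl _

theorem MonLE.total (α β : Fin 2 →₀ ℕ) : MonLE α β ∨ MonLE β α := le_total _ _

theorem MonLE.antisymm {α β : Fin 2 →₀ ℕ} (h : MonLE α β) (h' : MonLE β α) : α = β := by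
  rw [monLE_iff] at h h'
  ext i
  fin_cases i <;> simp only [Fin.zero_eta, Fin.mk_one] <;> omega

theorem MonDvd.refl (α : Fin 2 →₀ ℕ) : MonDvd α α := ⟨0, zero_mem _, (add_zero α).symm⟩

theorem MonDvd.trans {α β γ : Fin 2 →₀ ℕ} (h : MonDvd α β) (h' : MonDvd β γ) : MonDvd α γ := by
  obtain ⟨δ, hδ, rfl⟩ := h
  obtain ⟨ε, hε, rfl⟩ := h'
  exact ⟨δ + ε, add_mem hδ hε, add_assoc _ _ _⟩

theorem MonDvd.monLE {α β : Fin 2 →₀ ℕ} (h : MonDvd α β) : MonLE α β := by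
  obtain ⟨δ, hδ, rfl⟩ := h
  rw [mem_expSemigroup_iff] at hδ
  rw [monLE_iff]
  simp only [Finsupp.add_apply]
  omega

/-- The exponents of the monomials that are not standard for `J_n`. -/
def nonStd (n : ℕ) : Set (Fin 2 →₀ ℕ) :=
  {γ | γ ∈ expSemigroup ∧ γ ∉ Set.range (stdMon (n := n))}

/-- Here 2γ₀ - γ₁ is m + j for even m (γ₀ ≤ γ₁) and m + j + 1 for odd m (γ₀ > γ₁). Truncated
subtraction is harmless, since γ₁ ≤ 2γ₀ on the cone. -/
theorem mem_nonStd_iff {n : ℕ} {γ : Fin 2 →₀ ℕ} :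
    γ ∈ nonStd n ↔ 3 * γ 1 ≤ 4 * γ 0 ∧
      (n + 1 < 2 * γ 0 - γ 1 ∨ n + 1 = 2 * γ 0 - γ 1 ∧ γ 0 ≤ γ 1) := by
  rw [nonStd, Set.mem_ofPred_eq, ← mem_expSemigroup_iff]
  refine and_congr_right fun hγ => ?_
  obtain ⟨x, rfl⟩ := exists_stdExp_eq hγ
  have : stdExp x ∈ Set.range (stdMon (n := n)) ↔ x.1 + x.2 ≤ n := by
    constructor
    · rintro ⟨i, hi⟩
      rw [← stdExp_injective hi]
      exact i.2
    · intro h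
      exact ⟨⟨toLex x, h⟩, rfl⟩
  rw [this, stdExp_zero, stdExp_one]
  split_ifs <;> omega

/-- The standard monomials form an initial segment. -/
theorem mem_nonStd_of_monLE {n : ℕ} {α β : Fin 2 →₀ ℕ} (hα : α ∈ nonStd n)
    (hβ : β ∈ expSemigroup) (h : MonLE α β) : β ∈ nonStd n := by
  rw [mem_expSemigroup_iff] at hβ
  rw [mem_nonStd_iff] at hα ⊢
  rw [monLE_iff] at h
  omega

theorem mem_nonStd_of_monDvd {n : ℕ} {α β : Fin 2 →₀ ℕ} (hα : α ∈ nonStd n)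
    (h : MonDvd α β) : β ∈ nonStd n := by
  refine mem_nonStd_of_monLE hα ?_ h.monLE
  obtain ⟨δ, hδ, rfl⟩ := h
  exact add_mem hα.1 hδ

/-- The exponents of the minimal monomials that are not standard for `J_n`. -/
def minNonStd (n : ℕ) : Set (Fin 2 →₀ ℕ) :=
  {γ | γ ∈ nonStd n ∧ ∀ α ∈ nonStd n, MonDvd α γ → α = γ}

/-- Division by u or w lowers 2γ₀ - γ₁ by 2, so a minimal nonstandard exponent has 2γ₀ - γ₁ ≤ n + 3,
which bounds a region of the cone. -/
theorem finite_minNonStd (n : ℕ) : (minNonStd n).Finite := by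
  refine Set.Finite.subset (Set.finite_Iic (expVec (3 * n + 12) (3 * n + 12))) ?_
  rintro γ ⟨hγ, hmin⟩
  by_contra hlarge
  have hbig : n + 3 < 2 * γ 0 - γ 1 := by
    by_contra h
    refine hlarge fun i => ?_
    have := mem_nonStd_iff.1 hγ
    fin_cases i
    · simp only [Fin.zero_eta, expVec_zero]
      omega
    · simp only [Fin.mk_one, expVec_one]
      omega
  have hS := (mem_nonStd_iff.1 hγ).1
  obtain ⟨a, b, hab, h0, h1, hle, ha⟩ : ∃ a b, 3 * b ≤ 4 * a ∧ a ≤ γ 0 ∧ b ≤ γ 1 ∧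
      3 * (γ 1 - b) ≤ 4 * (γ 0 - a) ∧ 0 < a ∧ 2 * a - b ≤ 2 := by
    by_cases h : γ 0 ≤ γ 1
    · exact ⟨3, 4, by omega, by omega, by omega, by omega, by omega, by omega⟩
    · exact ⟨1, 0, by omega, by omega, by omega, by omega, by omega, by omega⟩
  have hγ' : γ = expVec (γ 0 - a) (γ 1 - b) + expVec a b := by
    ext i
    fin_cases i
    · simp only [Fin.zero_eta, Finsupp.add_apply, expVec_zero]
      omega
    · simp only [Fin.mk_one, Finsupp.add_apply, expVec_one]
      omega
  have := hmin (expVec (γ 0 - a) (γ 1 - b))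
    (by rw [mem_nonStd_iff, expVec_zero, expVec_one]; omega)
    ⟨expVec a b, by rw [mem_expSemigroup_iff, expVec_zero, expVec_one]; omega, hγ'⟩
  have := congrArg (· 0) this
  simp only [expVec_zero] at this
  omega

theorem exists_minNonStd_monDvd {n : ℕ} {γ : Fin 2 →₀ ℕ} (hγ : γ ∈ nonStd n) :
    ∃ α ∈ minNonStd n, MonDvd α γ := by
  induction hk : γ 0 + γ 1 using Nat.strong_induction_on generalizing γ with
  | _ k ih =>
    by_cases hmin : ∀ α ∈ nonStd n, MonDvd α γ → α = γ
    · exact ⟨γ, ⟨hγ, hmin⟩, MonDvd.refl γ⟩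
    · push Not at hmin
      obtain ⟨α, hα, hdvd, hne⟩ := hmin
      have hlt : α 0 + α 1 < k := by
        obtain ⟨δ, hδ, rfl⟩ := hdvd
        by_contra hle
        simp only [Finsupp.add_apply] at hk
        refine hne ?_
        ext i
        fin_cases i <;> simp only [Fin.zero_eta, Fin.mk_one, Finsupp.add_apply] <;> omega
      obtain ⟨β, hβ, hβα⟩ := ih _ hlt hα rfl
      exact ⟨β, hβ, hβα.trans hdvd⟩

/-! ### The reduced Gröbner basis over a field, and its reduction modulo p. -/

section Groebner

variable {K : Type*} [Field K]

theorem coe_mem_support {f : toricAlg K} {γ : Fin 2 →₀ ℕ}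
    (hγ : γ ∈ (f : MvPolynomial (Fin 2) K).support) : γ ∈ expSemigroup :=
  mem_toricAlg_iff.1 f.2 γ hγ

/-- If the leading exponent were standard, so would be every exponent below it, and independence
would force `f = 0`. -/
theorem mem_nonStd_of_isLeadingExp {n : ℕ} {f : toricAlg K} (hf : f ∈ idealJ K n)
    {α : Fin 2 →₀ ℕ} (hα : IsLeadingExp f α) : α ∈ nonStd n := by
  by_contra h
  have : f = 0 := eq_zero_of_mem_idealJ hf fun γ hγ => by
    by_contra hγ'
    exact h (mem_nonStd_of_monLE ⟨coe_mem_support hγ, hγ'⟩ (coe_mem_support hα.1) (hα.2 γ hγ))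
  simpa [this] using hα.1

theorem coeff_reductor_self {n : ℕ} {γ : Fin 2 →₀ ℕ} (hγ : γ ∈ nonStd n) :
    (reductor K n γ hγ.1 : MvPolynomial (Fin 2) K).coeff γ = 1 := by
  rw [coeff_reductor_of_notMem hγ.1 hγ.2, if_pos rfl]

theorem eq_of_mem_support_reductor {n : ℕ} {γ δ : Fin 2 →₀ ℕ} (hγ : γ ∈ nonStd n)
    (hδ : δ ∈ nonStd n)
    (h : δ ∈ (reductor K n γ hγ.1 : MvPolynomial (Fin 2) K).support) : γ = δ := by
  by_contra hne
  rw [mem_support_iff, coeff_reductor_of_notMem hγ.1 hδ.2, if_neg hne] at h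
  exact h rfl

theorem isLeadingExp_reductor {n : ℕ} {γ : Fin 2 →₀ ℕ} (hγ : γ ∈ nonStd n) :
    IsLeadingExp (reductor K n γ hγ.1) γ := by
  refine ⟨by rw [mem_support_iff, coeff_reductor_self hγ]; exact one_ne_zero, fun δ hδ => ?_⟩
  rcases MonLE.total δ γ with h | h
  · exact h
  · rw [eq_of_mem_support_reductor hγ (mem_nonStd_of_monLE hγ (coe_mem_support hδ) h) hδ]
    exact MonLE.refl δ

variable (K) in
theorem initialIdeal_idealJ (n : ℕ) :
    initialIdeal (idealJ K n) = monomialIdeal K (nonStd n) := by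
  rw [initialIdeal]
  congr 1
  ext α
  constructor
  · rintro ⟨f, hf, hα⟩
    exact mem_nonStd_of_isLeadingExp hf hα
  · exact fun hα => ⟨_, reductor_mem_idealJ n α hα.1, isLeadingExp_reductor hα⟩

theorem exists_monDvd_of_mem_monomialIdeal {S : Set (Fin 2 →₀ ℕ)} {f : toricAlg K}
    (hf : f ∈ monomialIdeal K S) {γ : Fin 2 →₀ ℕ}
    (hγ : γ ∈ (f : MvPolynomial (Fin 2) K).support) : ∃ α ∈ S, MonDvd α γ := by
  classical
  induction hf using Submodule.span_induction generalizing γ with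
  | mem x hx =>
    obtain ⟨α, hα, hx⟩ := hx
    rw [hx] at hγ
    have := support_monomial_subset hγ
    rw [Finset.mem_singleton] at this
    exact ⟨α, hα, this ▸ MonDvd.refl α⟩
  | zero => simp at hγ
  | add x y _ _ hx hy =>
    rcases Finset.mem_union.1 (support_add hγ) with h | h
    exacts [hx h, hy h]
  | smul r x _ hx =>
    obtain ⟨a, ha, b, hb, rfl⟩ := Finset.mem_add.1 (support_mul _ _ hγ)
    obtain ⟨α, hα, hdvd⟩ := hx hb
    exact ⟨α, hα, hdvd.trans ⟨a, coe_mem_support ha, add_comm _ _⟩⟩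

theorem monomialIdeal_mono_of_monDvd {S T : Set (Fin 2 →₀ ℕ)} (hS : S ⊆ expSemigroup)
    (h : ∀ γ ∈ T, ∃ α ∈ S, MonDvd α γ) : monomialIdeal K T ≤ monomialIdeal K S := by
  refine Ideal.span_le.2 ?_
  rintro m ⟨γ, hγ, hm⟩
  obtain ⟨α, hα, δ, hδ, rfl⟩ := h γ hγ
  have : m = toricMonomial δ hδ 1 * toricMonomial α (hS hα) 1 := by
    ext1
    rw [hm, MulMemClass.coe_mul, toricMonomial, toricMonomial, monomial_mul, one_mul, add_comm]
  rw [this]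
  exact Ideal.mul_mem_left _ _ (Ideal.subset_span ⟨α, hα, rfl⟩)

variable (K) in
/-- The reduced marked Gröbner basis of `J_n`. -/
def reductorBasis (n : ℕ) : Set (toricAlg K × (Fin 2 →₀ ℕ)) :=
  Set.range fun γ : minNonStd n => (reductor K n γ.1 γ.2.1.1, γ.1)

theorem isReducedMarkedGB_reductorBasis (n : ℕ) :
    IsReducedMarkedGB (idealJ K n) (reductorBasis K n) where
  finite := by
    have := (finite_minNonStd n).to_subtype
    exact Set.finite_range _
  mem := by
    rintro _ ⟨γ, rfl⟩
    exact reductor_mem_idealJ n _ _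
  marked := by
    rintro _ ⟨γ, rfl⟩
    exact isLeadingExp_reductor γ.2.1
  initial := by
    have : {α | ∃ x ∈ reductorBasis K n, x.2 = α} = minNonStd n := by
      ext α
      constructor
      · rintro ⟨_, ⟨γ, rfl⟩, rfl⟩
        exact γ.2
      · exact fun hα => ⟨_, ⟨⟨α, hα⟩, rfl⟩, rfl⟩
    rw [this, initialIdeal_idealJ]
    exact le_antisymm
      (monomialIdeal_mono_of_monDvd (fun γ hγ => hγ.1) fun γ hγ => ⟨γ, hγ.1, MonDvd.refl γ⟩)
      (monomialIdeal_mono_of_monDvd (fun γ hγ => hγ.1.1) fun γ hγ => exists_minNonStd_monDvd hγ)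
  monic := by
    rintro _ ⟨γ, rfl⟩
    exact coeff_reductor_self γ.2.1
  reduced := by
    rintro _ ⟨γ, rfl⟩ _ ⟨δ, rfl⟩ hne ε hε hdvd
    have h := eq_of_mem_support_reductor δ.2.1 (mem_nonStd_of_monDvd γ.2.1 hdvd) hε
    refine hne ?_
    rw [Subtype.ext (δ.2.2 γ.1 γ.2.1 (h ▸ hdvd))]

theorem IsReducedMarkedGB.eq_reductorBasis {n : ℕ} {G : Set (toricAlg K × (Fin 2 →₀ ℕ))}
    (hG : IsReducedMarkedGB (idealJ K n) G) : G = reductorBasis K n := by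
  have hnonStd : ∀ x ∈ G, x.2 ∈ nonStd n := fun x hx =>
    mem_nonStd_of_isLeadingExp (hG.mem x hx) (hG.marked x hx)
  have hmin : ∀ γ ∈ minNonStd n, ∃ x ∈ G, x.2 = γ := by
    intro γ hγ
    have hmem : toricMonomial γ hγ.1.1 1 ∈ monomialIdeal K {α | ∃ x ∈ G, x.2 = α} := by
      rw [hG.initial, initialIdeal_idealJ]
      exact Ideal.subset_span ⟨γ, hγ.1, rfl⟩
    obtain ⟨_, ⟨x, hx, rfl⟩, hdvd⟩ := exists_monDvd_of_mem_monomialIdeal hmem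
      (γ := γ) (by simp [toricMonomial])
    exact ⟨x, hx, hγ.2 _ (hnonStd x hx) hdvd⟩
  -- A nonstandard exponent of `x.1` is divisible by some minimal one, which leads an element of
  -- `G`. Reducedness makes that element `x`, and divisibility together with maximality of the
  -- leading exponent gives equality.
  have hdvd : ∀ x ∈ G, ∀ δ ∈ (x.1 : MvPolynomial (Fin 2) K).support, δ ∈ nonStd n →
      δ = x.2 ∧ x.2 ∈ minNonStd n := by
    intro x hx δ hδ hδ'
    obtain ⟨γ, hγ, hγδ⟩ := exists_minNonStd_monDvd hδ'
    obtain ⟨y, hy, rfl⟩ := hmin γ hγ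
    obtain rfl : y = x := by
      by_contra hne
      exact hG.reduced y hy x hx hne δ hδ hγδ
    exact ⟨((hG.marked y hy).2 δ hδ).antisymm hγδ.monLE, hγ⟩
  have hmem : ∀ x ∈ G, x.2 ∈ minNonStd n := fun x hx =>
    (hdvd x hx x.2 (hG.marked x hx).1 (hnonStd x hx)).2
  -- The leading terms cancel and only standard monomials remain, so the difference is zero by
  -- independence.
  have heq : ∀ (x) (hx : x ∈ G), x.1 = reductor K n x.2 (hnonStd x hx).1 := by
    intro x hx
    rw [← sub_eq_zero]
    refine eq_zero_of_mem_idealJ (sub_mem (hG.mem x hx) (reductor_mem_idealJ n _ _))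
      fun δ hδ => ?_
    by_contra hstd
    have hδS : δ ∈ nonStd n := ⟨coe_mem_support hδ, hstd⟩
    rw [mem_support_iff, AddSubgroupClass.coe_sub, coeff_sub,
      coeff_reductor_of_notMem _ hstd] at hδ
    by_cases hδx : x.2 = δ
    · rw [if_pos hδx, ← hδx, hG.monic x hx, sub_self] at hδ
      exact hδ rfl
    · rw [if_neg hδx, sub_zero, ← mem_support_iff] at hδ
      exact hδx (hdvd x hx δ hδ hδS).1.symm
  ext x
  constructor
  · exact fun hx => ⟨⟨x.2, hmem x hx⟩, Prod.ext (heq x hx).symm rfl⟩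
  · rintro ⟨⟨γ, hγ⟩, rfl⟩
    obtain ⟨x, hx, rfl⟩ := hmin γ hγ
    convert hx
    exact Prod.ext (heq x hx).symm rfl

variable (K) in
theorem existsUnique_isReducedMarkedGB (n : ℕ) : ∃! G, IsReducedMarkedGB (idealJ K n) G :=
  ⟨_, isReducedMarkedGB_reductorBasis n, fun _ hG => hG.eq_reductorBasis⟩

theorem isIntegralForm_reductor {n : ℕ} {γ : Fin 2 →₀ ℕ} (hγ : γ ∈ expSemigroup) :
    IsIntegralForm (reductor ℂ n γ hγ) (reductor ℤ n γ hγ) :=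
  map_reductor _ _ _ _

/-- Uniqueness makes the existential choice of integral form in `markedMod` immaterial. -/
theorem IsIntegralForm.unique {g : toricAlg ℂ} {h h' : toricAlg ℤ} (hh : IsIntegralForm g h)
    (hh' : IsIntegralForm g h') : h = h' :=
  Subtype.ext (map_injective _ (RingHom.injective_int _) (hh.trans hh'.symm))

theorem reduceMod_reductor (p : ℕ) [CharP K p] {n : ℕ} {γ : Fin 2 →₀ ℕ} (hγ : γ ∈ expSemigroup) :
    reduceMod p K (reductor ℤ n γ hγ) = reductor K n γ hγ := by
  rw [reduceMod, map_reductor, map_reductor]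

theorem markedMod_reductorBasis (p : ℕ) [CharP K p] (n : ℕ) :
    markedMod p K (reductorBasis ℂ n) = reductorBasis K n := by
  ext y
  constructor
  · rintro ⟨_, ⟨γ, rfl⟩, h, hh, hy, hy'⟩
    rw [hh.unique (isIntegralForm_reductor _), reduceMod_reductor] at hy
    exact ⟨γ, (Prod.ext (Subtype.ext hy) hy').symm⟩
  · rintro ⟨γ, rfl⟩
    exact ⟨_, ⟨γ, rfl⟩, _, isIntegralForm_reductor _, (reduceMod_reductor p _).symm, rfl⟩

end Groebner

end A3

theorem mainTheorem4 (n p : ℕ) (hp : p.Prime) (K : Type*) [Field K] [CharP K p] :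
    (∃! G, A3.IsReducedMarkedGB (A3.idealJ ℂ n) G) ∧
    (∃! G, A3.IsReducedMarkedGB (A3.idealJ K n) G) ∧
    ∀ G₀ Gp, A3.IsReducedMarkedGB (A3.idealJ ℂ n) G₀ → A3.IsReducedMarkedGB (A3.idealJ K n) Gp →
      (∀ x ∈ G₀, ∃ h : A3.toricAlg ℤ, A3.IsIntegralForm x.1 h) ∧
      Gp = A3.markedMod p K G₀ := by
  refine ⟨A3.existsUnique_isReducedMarkedGB ℂ n, A3.existsUnique_isReducedMarkedGB K n, ?_⟩
  intro G₀ Gp h₀ hGp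
  rw [h₀.eq_reductorBasis, hGp.eq_reductorBasis, A3.markedMod_reductorBasis]
  refine ⟨?_, rfl⟩
  rintro _ ⟨γ, rfl⟩
  exact ⟨_, A3.isIntegralForm_reductor _⟩
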